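/- All logarithms are to base $2$. Let $K\ge 1$ and let $G$ be the generating matrix of a perfect $K\times K$ space-time code over the Gaussian integers, that is, a matrix $G\in\mathbb C^{K^2\times K^2}$ (full rate: $K^2$ information symbols over $T=K$ time extensions) whose rows are indexed by the pairs (time slot, source), such that - $G$ is unitary; - the code has non-vanishing determinant: writing $X_s\in\mathbb C^{K\times K}$ for the matrix whose stacked columns form $Gs$, the minimum determinant $$\delta_{\min}=\inf\bigl\{|\det X_s|^2 : s\in\mathbb Z[i]^{K^2},\ X_s\neq 0\bigr\}$$ is strictly positive. Let $P_{st}\in\mathbb R^{2K^2\times 2K^2}$ be the real representation of the precoder $G^{H}$, each complex entry $z$ being replaced by the block $\begin{pmatrix}\operatorname{Re}z&-\operatorname{Im}z\\ \operatorname{Im}z&\operatorname{Re}z\end{pmatrix}$. Let $K_{xx}\in\mathbb R^{K\times K}$ be any covariance (symmetric positive semidefinite) matrix of $K$ Gaussian sources, let $d>0$ be the distortion level, and put $$R_{\rm BT}=\tfrac12\log\det\bigl(I+\tfrac1d K_{xx}\bigr)$$ (the Berger–Tung benchmark). Two real time slots are combined into one complex slot and $K$ complex slots are stacked, which gives the covariance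 matrix $\mathcal K=I_{K}\otimes(I_2\otimes K_{xx})$ of size $2K^2$ (coordinates of $P_{st}$ ordered accordingly). The rate of space-time integer-forcing source coding, normalized by the number $2K$ of stacked real time slots, is $$R_{\rm IF}=\frac1{2K}\cdot\frac{2K^2}{2}\log\Bigl(\min_{A\in\mathbb Z^{2K^2\times 2K^2},\ \det A\ne0}\ \max_{1\le k\le 2K^2} a_k^T\bigl(I+\tfrac1d P_{st}\mathcal K P_{st}^T\bigr)a_k\Bigr),$$ where $a_k^T$ is the $k$-th row of $A$. Then $$R_{\rm IF}-R_{\rm BT}\le 2K^3\log(2K^2)+K^2\log\frac1{\delta_{\min}}.$$ The bound holds for every $K_{xx}$ and every $d>0$; its right-hand side depends on neither. -/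

import Mathlib

open scoped Matrix Kronecker

namespace IFSource

/-- The Berger--Tung benchmark (in bits) of a source vector with covariance matrix `C` at
distortion `d`: `(1/2) log₂ det (I + C / d)`. -/
noncomputable def bergerTungRate {ι : Type*} [Fintype ι] [DecidableEq ι]
    (d : ℝ) (C : Matrix ι ι ℝ) : ℝ :=
  1 / 2 * Real.logb 2 (1 + (1 / d) • C).det

/-- The effective variance `aᵀ (I + C / d) a` of the integer combination `a`. -/
noncomputable def effectiveVariance {ι : Type*} [Fintype ι] [DecidableEq ι]
    (d : ℝ) (C : Matrix ι ι ℝ) (a : ι → ℤ) : ℝ :=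
  (fun i => (a i : ℝ)) ⬝ᵥ ((1 + (1 / d) • C) *ᵥ (fun i => (a i : ℝ)))

/-- The optimal sum rate (in bits) of integer-forcing source coding of a source vector with
covariance matrix `C` at distortion `d`:
`(n/2) log₂ min_A max_k a_kᵀ (I + C / d) a_k`, where `n` is the number of components and `A`
ranges over the integer `n × n` matrices with nonzero determinant, with rows `a_k`. -/
noncomputable def integerForcingRate {ι : Type*} [Fintype ι] [DecidableEq ι]
    (d : ℝ) (C : Matrix ι ι ℝ) : ℝ :=
  (Fintype.card ι : ℝ) / 2 *
    Real.logb 2 (⨅ A : {A : Matrix ι ι ℤ // A.det ≠ 0}, ⨆ k, effectiveVariance d C (A.1 k))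

/-- The codeword (rows: antennas or sources, columns: time slots) carrying the vector `s` of
Gaussian-integer information symbols, in the linear dispersion space-time code with generating
matrix `G`. The rows of `G` are indexed by pairs (time slot, antenna), so that stacking the
columns of the codeword gives `G s`. -/
noncomputable def codeword {K N : ℕ} (G : Matrix (Fin K × Fin K) (Fin N) ℂ)
    (s : Fin N → GaussianInt) : Matrix (Fin K) (Fin K) ℂ :=
  Matrix.of fun k t => (G *ᵥ fun n => GaussianInt.toComplex (s n)) (t, k)

/-- The (infinite) space-time code over the Gaussian integers with generating matrix `G`. -/
def spaceTimeCode {K N : ℕ} (G : Matrix (Fin K × Fin K) (Fin N) ℂ) :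
    Set (Matrix (Fin K) (Fin K) ℂ) :=
  Set.range (codeword G)

/-- The minimum determinant `δ_min` of the code: the infimum of `|det X|²` over the nonzero
codewords `X`. -/
noncomputable def minDet {K N : ℕ} (G : Matrix (Fin K × Fin K) (Fin N) ℂ) : ℝ :=
  sInf ((fun X : Matrix (Fin K) (Fin K) ℂ => ‖X.det‖ ^ 2) '' {X ∈ spaceTimeCode G | X ≠ 0})

/-- `G` generates a perfect `K × K` space-time code (so `T = K` time extensions are used). -/
structure IsPerfectCode {K N : ℕ} (G : Matrix (Fin K × Fin K) (Fin N) ℂ) : Prop where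
  /-- `K` information symbols per time extension are transmitted. -/
  fullRate : N = K * K
  /-- The determinants of the nonzero codewords are bounded away from zero. -/
  nonvanishingDet : 0 < minDet G
  /-- The generating matrix is unitary: orthonormal columns. -/
  unitary_left : Gᴴ * G = 1
  /-- The generating matrix is unitary: orthonormal rows. -/
  unitary_right : G * Gᴴ = 1

/-- The covariance matrix `I_T ⊗ (I_2 ⊗ C)` of the stacked source vector, for `T = K`:
`K` time extensions of a complex vector, each with independent real and imaginary parts of
covariance `C`. -/
def stackedCovariance {K : ℕ} (C : Matrix (Fin K) (Fin K) ℝ) :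
    Matrix (Fin K × (Fin 2 × Fin K)) (Fin K × (Fin 2 × Fin K)) ℝ :=
  (1 : Matrix (Fin K) (Fin K) ℝ) ⊗ₖ ((1 : Matrix (Fin 2) (Fin 2) ℝ) ⊗ₖ C)

/-- The real representation of a complex matrix acting on stacked vectors: each complex entry `z`
becomes the block `!![re z, -im z; im z, re z]` (component `0` is the real part and component `1`
the imaginary part). The columns are ordered as in `stackedCovariance`. -/
def realRepresentation {K N : ℕ} (P : Matrix (Fin N) (Fin K × Fin K) ℂ) :
    Matrix (Fin 2 × Fin N) (Fin K × (Fin 2 × Fin K)) ℝ :=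
  Matrix.of fun i j =>
    !![(P i.2 (j.1, j.2.2)).re, -(P i.2 (j.1, j.2.2)).im;
       (P i.2 (j.1, j.2.2)).im, (P i.2 (j.1, j.2.2)).re] i.1 j.2.1

/-- The real precoding matrix `P_st` induced by the space-time code with generating matrix `G`.
The precoder applied to the sources is `Gᴴ`; an integer combination `a` of the precoded
components then is the combination of the stacked sources with coefficients `P_stᵀ a`, which is
the real representation of `G a`, i.e. of a codeword. -/
def precodingMatrix {K N : ℕ} (G : Matrix (Fin K × Fin K) (Fin N) ℂ) :
    Matrix (Fin 2 × Fin N) (Fin K × (Fin 2 × Fin K)) ℝ :=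
  realRepresentation Gᴴ

/-- The rate of space-time integer-forcing source coding of a source with covariance matrix `C`,
precoded by the code with generating matrix `G`, normalized by the number `2 T = 2 K` of real
time extensions that are stacked. -/
noncomputable def spaceTimeRate {K N : ℕ} (d : ℝ) (C : Matrix (Fin K) (Fin K) ℝ)
    (G : Matrix (Fin K × Fin K) (Fin N) ℂ) : ℝ :=
  1 / (2 * (K : ℝ)) *
    integerForcingRate d (precodingMatrix G * stackedCovariance C * (precodingMatrix G)ᵀ)

end IFSource

namespace IFSource

/-! The rate is governed by a lattice problem for the form `aᵀ M a`, where `M` is the precoded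
covariance plus noise and `n = 2K²`. Let `D = det (I + Kxx / d)` and let `r` be the min-max in the
rate. No integer vector is short: `aᵀ M a` is the squared Frobenius norm of `B X`, with `X` a
codeword and `BᵀB = I + Kxx / d`. It is therefore at least `|det (B X)|^(2/K) ≥ μ = (δ_min D)^(1/K)`
for `a ≠ 0` (`minDet_mul_det_le`). Unitarity gives `det M = D^(2K)`, and a weak Minkowski second
theorem (`mul_pow_le_card_pow_mul_det_sq`) gives `r μ^(n-1) ≤ n^n det M`. After taking logarithms,
the powers of `D` cancel down to exactly the Berger–Tung rate. -/

/-! ### Geometry of numbers: Minkowski's theorems for ellipsoids. -/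

open MeasureTheory in
/-- **Minkowski's theorem** for the ellipsoid `‖A x‖ < 1`, via an inscribed parallelepiped. -/
theorem exists_int_dotProduct_mulVec_lt_one {ι : Type*} [Fintype ι] [DecidableEq ι] [Nonempty ι]
    (A : Matrix ι ι ℝ) (hA : A.det ≠ 0)
    (h : A.det ^ 2 * (Fintype.card ι : ℝ) ^ Fintype.card ι < 1) :
    ∃ x : ι → ℤ, x ≠ 0 ∧ A *ᵥ (fun i => (x i : ℝ)) ⬝ᵥ A *ᵥ (fun i => (x i : ℝ)) < 1 := by
  set n := Fintype.card ι
  have hn : 0 < (n : ℝ) := by exact_mod_cast Fintype.card_pos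
  -- The norm on `ι → ℝ` is the sup norm, so the ball of radius `1/√n` is an open cube inscribed in
  -- the Euclidean unit ball; `s` is its preimage, of volume `(2ρ)^n / |det A|`.
  set ρ : ℝ := 1 / √n
  have hρ : 0 < ρ := by positivity
  have hρ2 : ρ ^ 2 = 1 / n := by simp only [ρ, div_pow, Real.sq_sqrt hn.le, one_pow]
  set b := Pi.basisFun ℝ ι
  set s : Set (ι → ℝ) := Matrix.toLin' A ⁻¹' Metric.ball 0 ρ
  have hdet : LinearMap.det (Matrix.toLin' A) = A.det := LinearMap.det_toLin' A
  have hlt : |A.det| < ρ ^ n := by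
    refine lt_of_pow_lt_pow_left₀ 2 (by positivity) ?_
    rw [sq_abs, ← pow_mul, mul_comm n 2, pow_mul, hρ2, one_div, inv_pow, ← one_div,
      lt_div_iff₀ (by positivity)]
    exact h
  have hvol : volume (ZSpan.fundamentalDomain b) * 2 ^ Module.finrank ℝ (ι → ℝ) < volume s := by
    rw [ZSpan.fundamentalDomain_pi_basisFun, Real.volume_pi_Ico]
    simp only [sub_zero, ENNReal.ofReal_one, Finset.prod_const_one, one_mul]
    rw [Module.finrank_fintype_fun_eq_card,
      Measure.addHaar_preimage_linearMap _ (by rwa [hdet]), hdet, Real.volume_pi_ball _ hρ,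
      ← ENNReal.ofReal_mul (by positivity), mul_pow, abs_inv]
    rw [show (2 : ENNReal) ^ Fintype.card ι = ENNReal.ofReal (2 ^ n) by
      rw [ENNReal.ofReal_pow (by norm_num)]; simp [n]]
    rw [ENNReal.ofReal_lt_ofReal_iff (by positivity), mul_left_comm, lt_mul_iff_one_lt_right
      (by positivity), inv_mul_eq_div, one_lt_div (by positivity)]
    exact hlt
  have : Countable (Submodule.span ℤ (Set.range b)).toAddSubgroup :=
    inferInstanceAs (Countable (Submodule.span ℤ (Set.range b)))
  obtain ⟨x, hx0, hx⟩ := exists_ne_zero_mem_lattice_of_measure_mul_two_pow_lt_measure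
    (L := (Submodule.span ℤ (Set.range b)).toAddSubgroup)
    (ZSpan.isAddFundamentalDomain b volume) (s := s)
    (fun x hx => by simpa [s, Matrix.mulVec_neg] using hx)
    ((convex_ball (0 : ι → ℝ) ρ).linear_preimage _) hvol
  have hmem : (x : ι → ℝ) ∈ Submodule.span ℤ (Set.range b) := x.2
  rw [Module.Basis.mem_span_iff_repr_mem] at hmem
  choose y hy using hmem
  have hxy : (x : ι → ℝ) = fun i => (y i : ℝ) := by
    funext i
    simpa [b] using (hy i).symm
  refine ⟨y, ?_, ?_⟩
  · rintro rfl
    exact hx0 (Subtype.ext (by rw [hxy]; ext; simp))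
  · rw [← hxy]
    have hx' : ∀ i, |(A *ᵥ (x : ι → ℝ)) i| < ρ := by
      simpa [s, pi_norm_lt_iff hρ] using hx
    calc _ = ∑ i, |(A *ᵥ (x : ι → ℝ)) i| ^ 2 := by
          simp [dotProduct, sq]
      _ < ∑ _i : ι, ρ ^ 2 := Finset.sum_lt_sum_of_nonempty Finset.univ_nonempty fun i _ =>
          pow_lt_pow_left₀ (hx' i) (abs_nonneg _) two_ne_zero
      _ = 1 := by
          rw [Finset.sum_const, hρ2, Finset.card_univ, nsmul_eq_mul]
          exact mul_one_div_cancel hn.ne'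

/-- If every square matrix with rows in a set of integer vectors is singular, some nonzero linear form vanishes on it. -/
theorem exists_form_vanishing {ι : Type*} [Fintype ι] [DecidableEq ι] (T : Set (ι → ℤ))
    (hT : ∀ A : Matrix ι ι ℤ, (∀ k, A k ∈ T) → A.det = 0) :
    ∃ v : ι → ℝ, v ≠ 0 ∧ ∀ x ∈ T, v ⬝ᵥ (fun i => (x i : ℝ)) = 0 := by
  set c : (ι → ℤ) → ι → ℝ := fun x i => (x i : ℝ)
  have hlt : Submodule.span ℝ (c '' T) < ⊤ := by
    rw [lt_top_iff_ne_top]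
    intro htop
    -- A spanning set would contain a basis, whose vectors are the rows of an invertible integer
    -- matrix.
    obtain ⟨f, hf, -, hli⟩ := Submodule.exists_fun_fin_finrank_span_eq ℝ (c '' T)
    have hcard : Module.finrank ℝ (Submodule.span ℝ (c '' T)) = Fintype.card ι := by
      rw [htop, finrank_top, Module.finrank_fintype_fun_eq_card]
    let e : ι ≃ Fin (Module.finrank ℝ (Submodule.span ℝ (c '' T))) :=
      Fintype.equivOfCardEq (by simp [hcard])
    choose g hg hgf using hf
    have hli' := hli.comp e e.injective
    let A : Matrix ι ι ℤ := Matrix.of fun k => g (e k)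
    have hA : (A.map (Int.castRingHom ℝ)).row = f ∘ e := by
      funext k
      exact hgf (e k)
    rw [← hA, Matrix.linearIndependent_rows_iff_isUnit, Matrix.isUnit_iff_isUnit_det,
      ← RingHom.mapMatrix_apply, ← RingHom.map_det, hT A fun k => hg (e k)] at hli'
    simp at hli'
  obtain ⟨f, hf0, hf⟩ := Submodule.exists_le_ker_of_lt_top _ hlt
  have hfv : ∀ x, (fun i => f (Pi.single i 1)) ⬝ᵥ x = f x := fun x => by
    conv_rhs => rw [← Finset.univ_sum_single x]
    rw [map_sum]
    refine Finset.sum_congr rfl fun i _ => ?_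
    rw [← mul_one (x i), ← smul_eq_mul (x i) 1, Pi.single_smul', map_smul]
    simp [mul_comm]
  refine ⟨fun i => f (Pi.single i 1), fun h => hf0 (LinearMap.ext fun x => ?_), fun x hx => ?_⟩
  · rw [← hfv, h]; simp
  · rw [hfv]
    exact hf (Submodule.subset_span ⟨x, hx, rfl⟩)

/-- Weak form of **Minkowski's second theorem** for the quadratic form `‖B x‖²`. -/
theorem mul_pow_le_card_pow_mul_det_sq {ι : Type*} [Fintype ι] [DecidableEq ι] [Nonempty ι]
    (B : Matrix ι ι ℝ) (hB : B.det ≠ 0) {μ r : ℝ} (hμ : 0 < μ) (hμr : μ ≤ r)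
    (hmin : ∀ x : ι → ℤ, x ≠ 0 →
      μ ≤ B *ᵥ (fun i => (x i : ℝ)) ⬝ᵥ B *ᵥ (fun i => (x i : ℝ)))
    (hr : ∀ A : Matrix ι ι ℤ,
      (∀ k, B *ᵥ (fun i => (A k i : ℝ)) ⬝ᵥ B *ᵥ (fun i => (A k i : ℝ)) < r) → A.det = 0) :
    r * μ ^ (Fintype.card ι - 1) ≤ (Fintype.card ι : ℝ) ^ Fintype.card ι * B.det ^ 2 := by
  have hr0 : 0 < r := hμ.trans_le hμr
  obtain ⟨v, hv0, hv⟩ := exists_form_vanishing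
    {x : ι → ℤ | B *ᵥ (fun i => (x i : ℝ)) ⬝ᵥ B *ᵥ (fun i => (x i : ℝ)) < r} hr
  have hBu : IsUnit B.det := isUnit_iff_ne_zero.2 hB
  -- The vanishing form in the coordinates `y = B x`, normalized below to the unit vector `w`.
  set w₀ := v ᵥ* B⁻¹
  have hw₀v : w₀ ᵥ* B = v := by
    rw [Matrix.vecMul_vecMul, Matrix.nonsing_inv_mul _ hBu, Matrix.vecMul_one]
  have hw₀ : w₀ ≠ 0 := fun h => hv0 (by rw [← hw₀v, h, Matrix.zero_vecMul])
  have hw₀pos : 0 < w₀ ⬝ᵥ w₀ := by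
    have := Matrix.dotProduct_self_star_pos_iff.2 hw₀
    simpa using this
  set w := (1 / √(w₀ ⬝ᵥ w₀)) • w₀ with hw
  have hww : w ⬝ᵥ w = 1 := by
    rw [hw, smul_dotProduct, dotProduct_smul, smul_eq_mul, smul_eq_mul, ← mul_assoc, ← sq, div_pow,
      Real.sq_sqrt hw₀pos.le]
    field_simp
  have hwv : ∀ x, v ⬝ᵥ x = 0 → w ⬝ᵥ B *ᵥ x = 0 := fun x hx => by
    rw [hw, smul_dotProduct, Matrix.dotProduct_mulVec, hw₀v, hx, smul_zero]
  -- The matrix `A = α W B` rescales the form: the component of `B x` along `w` is divided by `√r`,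
  -- the orthogonal part by `√μ`. Hence `det A² = det B² / (r μ^(n-1))`, and the claim is that
  -- Minkowski's first theorem must fail for `A`.
  set γ := √(μ / r) - 1 with hγ
  have hγ2 : (1 + γ) ^ 2 = μ / r := by
    rw [hγ, add_sub_cancel, Real.sq_sqrt (by positivity)]
  set α := 1 / √μ
  have hα2 : α ^ 2 = 1 / μ := by simp only [α, div_pow, Real.sq_sqrt hμ.le, one_pow]
  set W : Matrix ι ι ℝ := 1 + Matrix.replicateCol Unit (γ • w) * Matrix.replicateRow Unit w
  have hWdet : W.det = 1 + γ := by
    rw [Matrix.det_one_add_replicateCol_mul_replicateRow, dotProduct_smul, hww, smul_eq_mul, mul_one]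
  have hW : ∀ y, W *ᵥ y = y + (γ * (w ⬝ᵥ y)) • w := fun y => by
    rw [Matrix.add_mulVec, Matrix.one_mulVec]
    congr 1
    ext i
    simp [Matrix.mulVec, dotProduct, Matrix.mul_apply, Finset.mul_sum, Finset.sum_mul]
    exact Finset.sum_congr rfl fun j _ => by ring
  set A := α • (W * B)
  have hAdet : A.det ^ 2 = (1 / μ) ^ Fintype.card ι * (μ / r) * B.det ^ 2 := by
    rw [Matrix.det_smul, Matrix.det_mul, hWdet, mul_pow, mul_pow, hγ2, ← pow_mul, mul_comm _ 2,
      pow_mul, hα2, mul_assoc]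
  have hA : ∀ x, A *ᵥ x ⬝ᵥ A *ᵥ x =
      (B *ᵥ x ⬝ᵥ B *ᵥ x - (w ⬝ᵥ B *ᵥ x) ^ 2) / μ + (w ⬝ᵥ B *ᵥ x) ^ 2 / r := fun x => by
    have : A *ᵥ x ⬝ᵥ A *ᵥ x = α ^ 2 * (B *ᵥ x ⬝ᵥ B *ᵥ x +
        ((1 + γ) ^ 2 - 1) * (w ⬝ᵥ B *ᵥ x) ^ 2) := by
      rw [Matrix.smul_mulVec, ← Matrix.mulVec_mulVec, hW]
      simp only [smul_dotProduct, dotProduct_smul, add_dotProduct, dotProduct_add, hww,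
        dotProduct_comm (B *ᵥ x) w, smul_eq_mul]
      ring
    rw [this, hα2, hγ2]
    field_simp
    ring
  have hCS : ∀ y, (w ⬝ᵥ y) ^ 2 ≤ y ⬝ᵥ y := fun y => by
    have := Finset.sum_mul_sq_le_sq_mul_sq Finset.univ w y
    have hww' : ∑ i, w i ^ 2 = 1 := by simpa [dotProduct, sq] using hww
    rw [hww', one_mul] at this
    simpa [dotProduct, sq] using this
  by_contra! hcon
  obtain ⟨x, hx0, hx⟩ := exists_int_dotProduct_mulVec_lt_one A
    (fun h => by
      rw [h] at hAdet
      have : 0 < (1 / μ) ^ Fintype.card ι * (μ / r) * B.det ^ 2 := by positivity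
      exact this.ne (by rw [← hAdet, zero_pow two_ne_zero]))
    (by
      rw [hAdet]
      obtain ⟨m, hm⟩ : ∃ m, Fintype.card ι = m + 1 :=
        ⟨_, (Nat.succ_pred_eq_of_pos Fintype.card_pos).symm⟩
      rw [hm, Nat.add_sub_cancel] at hcon
      rw [hm]
      calc _ = (((m + 1 : ℕ) : ℝ) ^ (m + 1) * B.det ^ 2) / (r * μ ^ m) := by
            rw [div_pow, one_pow, pow_succ μ]; field_simp
        _ < 1 := (div_lt_one (by positivity)).2 hcon)
  rw [hA] at hx
  set X : ι → ℝ := fun i => (x i : ℝ)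
  -- Below `r` the `w`-component vanishes and the new form is the old one over `μ`; otherwise the
  -- new form is at least the old one over `r`. Both are at least `1`.
  by_cases hxr : B *ᵥ X ⬝ᵥ B *ᵥ X < r
  · have h0 := hwv X (hv x hxr)
    rw [h0] at hx
    have := (one_le_div hμ).2 (hmin x hx0)
    simp at hx
    linarith
  · push Not at hxr
    have h1 := (one_le_div hr0).2 hxr
    have h2 : (B *ᵥ X ⬝ᵥ B *ᵥ X - (w ⬝ᵥ B *ᵥ X) ^ 2) / r ≤
        (B *ᵥ X ⬝ᵥ B *ᵥ X - (w ⬝ᵥ B *ᵥ X) ^ 2) / μ :=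
      div_le_div_of_nonneg_left (sub_nonneg.2 (hCS _)) hμ hμr
    rw [sub_div] at h2
    linarith

/-! ### Matrix factorization and a determinant bound. -/

open scoped MatrixOrder in
theorem _root_.Matrix.PosSemidef.exists_transpose_mul_self {ι : Type*} [Fintype ι] [DecidableEq ι]
    {M : Matrix ι ι ℝ} (hM : M.PosSemidef) : ∃ B : Matrix ι ι ℝ, M = Bᵀ * B := by
  obtain ⟨B, hB⟩ := CStarAlgebra.nonneg_iff_eq_star_mul_self.1 hM.nonneg
  exact ⟨B, by rw [hB, Matrix.star_eq_conjTranspose, Matrix.conjTranspose_eq_transpose_of_trivial]⟩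

open scoped ComplexOrder in
/-- The determinant of a matrix is bounded by a power of its Frobenius norm. -/
theorem norm_det_sq_le {ι : Type*} [Fintype ι] [DecidableEq ι] (Z : Matrix ι ι ℂ) :
    ‖Z.det‖ ^ 2 ≤ (∑ t, ∑ k, ‖Z k t‖ ^ 2) ^ Fintype.card ι := by
  have hY := Matrix.posSemidef_conjTranspose_mul_self Z
  have htr : ∑ i, hY.1.eigenvalues i = ∑ t, ∑ k, ‖Z k t‖ ^ 2 := by
    have h := hY.1.trace_eq_sum_eigenvalues
    have h2 : (Zᴴ * Z).trace = ((∑ t, ∑ k, ‖Z k t‖ ^ 2 : ℝ) : ℂ) := by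
      simp [Matrix.trace, Matrix.mul_apply, Complex.conj_mul']
    rw [h2] at h
    exact Complex.ofReal_injective ((Complex.ofReal_sum _ _).trans h.symm)
  have hdet : ∏ i, hY.1.eigenvalues i = ‖Z.det‖ ^ 2 := by
    have h := hY.1.det_eq_prod_eigenvalues
    rw [Matrix.det_mul, Matrix.det_conjTranspose, show star Z.det * Z.det = _ from
      Complex.conj_mul' Z.det] at h
    rw [← Complex.ofReal_pow] at h
    exact Complex.ofReal_injective ((Complex.ofReal_prod _ _).trans h.symm)
  rw [← hdet, ← htr, ← Finset.card_univ, ← Finset.prod_const]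
  -- Each eigenvalue of `ZᴴZ` is nonnegative, hence at most the trace.
  exact Finset.prod_le_prod (fun i _ => hY.eigenvalues_nonneg i) fun i hi =>
    Finset.single_le_sum (fun j _ => hY.eigenvalues_nonneg j) hi

/-! ### The real precoder and the stacked covariance. -/

variable {K N : ℕ}

/-- Transposing a real representation corresponds to conjugate transposition, which turns the
precoder `Gᴴ` back into `G`. -/
theorem precodingMatrix_transpose_mulVec (G : Matrix (Fin K × Fin K) (Fin N) ℂ)
    (a : Fin 2 × Fin N → ℤ) (t : Fin K) (c : Fin 2) (k : Fin K) :
    ((precodingMatrix G)ᵀ *ᵥ fun i => (a i : ℝ)) (t, c, k) =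
      ![(codeword G (fun n => ⟨a (0, n), a (1, n)⟩) k t).re,
        (codeword G (fun n => ⟨a (0, n), a (1, n)⟩) k t).im] c := by
  fin_cases c <;>
    simp [precodingMatrix, realRepresentation, codeword, Matrix.mulVec, dotProduct,
      Fintype.sum_prod_type, GaussianInt.toComplex_def, Finset.sum_add_distrib, sub_eq_add_neg,
      add_comm]

theorem precodingMatrix_mul_transpose {G : Matrix (Fin K × Fin K) (Fin N) ℂ} (hG : Gᴴ * G = 1) :
    precodingMatrix G * (precodingMatrix G)ᵀ = 1 := by
  ext ⟨c, n⟩ ⟨c', n'⟩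
  have h := congrFun (congrFun hG n) n'
  have hre := congrArg Complex.re h
  have him := congrArg Complex.im h
  fin_cases c <;> fin_cases c' <;>
    simp [precodingMatrix, realRepresentation, Matrix.mul_apply, Fintype.sum_prod_type,
      Matrix.one_apply, Finset.sum_add_distrib, apply_ite Complex.re, apply_ite Complex.im] at hre him ⊢ <;>
    linarith

theorem transpose_mul_precodingMatrix {G : Matrix (Fin K × Fin K) (Fin N) ℂ} (hG : G * Gᴴ = 1) :
    (precodingMatrix G)ᵀ * precodingMatrix G = 1 := by
  ext ⟨t, c, k⟩ ⟨t', c', k'⟩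
  have h := congrFun (congrFun hG (t, k)) (t', k')
  have hre := congrArg Complex.re h
  have him := congrArg Complex.im h
  fin_cases c <;> fin_cases c' <;>
    simp [precodingMatrix, realRepresentation, Matrix.mul_apply, Fintype.sum_prod_type,
      Matrix.one_apply, Finset.sum_add_distrib, apply_ite Complex.re, apply_ite Complex.im] at hre him ⊢ <;>
    linarith

theorem one_add_smul_stackedCovariance (d : ℝ) (C : Matrix (Fin K) (Fin K) ℝ) :
    1 + (1 / d) • stackedCovariance C = stackedCovariance (1 + (1 / d) • C) := by
  simp [stackedCovariance, Matrix.kronecker_add, Matrix.kronecker_smul]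

theorem det_stackedCovariance (C : Matrix (Fin K) (Fin K) ℝ) :
    (stackedCovariance C).det = C.det ^ (2 * K) := by
  simp [stackedCovariance, Matrix.det_kronecker, ← pow_mul]

theorem one_add_smul_conj_eq {G : Matrix (Fin K × Fin K) (Fin N) ℂ} (hG : Gᴴ * G = 1) (d : ℝ)
    (C : Matrix (Fin K) (Fin K) ℝ) :
    1 + (1 / d) • (precodingMatrix G * stackedCovariance C * (precodingMatrix G)ᵀ) =
      precodingMatrix G * stackedCovariance (1 + (1 / d) • C) * (precodingMatrix G)ᵀ := by
  rw [← one_add_smul_stackedCovariance, Matrix.mul_add, Matrix.add_mul, Matrix.mul_one,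
    precodingMatrix_mul_transpose hG, Matrix.mul_smul, Matrix.smul_mul]

/-- The two index types of the precoder differ, so its own determinant is unavailable; the identity
`det (1 + XY) = det (1 + YX)` brings the two precoders together instead. -/
theorem det_one_add_smul_conj {G : Matrix (Fin K × Fin K) (Fin N) ℂ} (hG : G * Gᴴ = 1) (d : ℝ)
    (C : Matrix (Fin K) (Fin K) ℝ) :
    (1 + (1 / d) • (precodingMatrix G * stackedCovariance C * (precodingMatrix G)ᵀ)).det =
      (1 + (1 / d) • C).det ^ (2 * K) := by
  rw [← Matrix.smul_mul, Matrix.det_one_add_mul_comm, ← Matrix.mul_smul, ← Matrix.mul_assoc,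
    transpose_mul_precodingMatrix hG, Matrix.one_mul, one_add_smul_stackedCovariance,
    det_stackedCovariance]

theorem stackedCovariance_mulVec (C : Matrix (Fin K) (Fin K) ℝ)
    (y : Fin K × Fin 2 × Fin K → ℝ) (t : Fin K) (c : Fin 2) (k : Fin K) :
    (stackedCovariance C *ᵥ y) (t, c, k) = (C *ᵥ fun k => y (t, c, k)) k := by
  simp [stackedCovariance, Matrix.mulVec, dotProduct, Fintype.sum_prod_type, Matrix.one_apply,
    ite_mul, Finset.sum_ite_eq]

/-- The effective variance is the squared Frobenius norm of a filtered codeword. -/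
theorem effectiveVariance_eq {G : Matrix (Fin K × Fin K) (Fin N) ℂ} (hG : Gᴴ * G = 1) (d : ℝ)
    (C B : Matrix (Fin K) (Fin K) ℝ) (hB : 1 + (1 / d) • C = Bᵀ * B) (a : Fin 2 × Fin N → ℤ) :
    effectiveVariance d (precodingMatrix G * stackedCovariance C * (precodingMatrix G)ᵀ) a =
      ∑ t, ∑ k, ‖(B.map Complex.ofReal *
        codeword G (fun n => ⟨a (0, n), a (1, n)⟩)) k t‖ ^ 2 := by
  rw [effectiveVariance, one_add_smul_conj_eq hG, hB, ← Matrix.mulVec_mulVec,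
    ← Matrix.mulVec_mulVec, Matrix.dotProduct_mulVec, ← Matrix.mulVec_transpose]
  set y := (precodingMatrix G)ᵀ *ᵥ fun i => (a i : ℝ) with hy
  have hyy : ∀ t c, (∑ k, y (t, c, k) * (stackedCovariance (Bᵀ * B) *ᵥ y) (t, c, k)) =
      ∑ k, (B *ᵥ fun k => y (t, c, k)) k ^ 2 := fun t c => by
    simp only [stackedCovariance_mulVec]
    change (fun k => y (t, c, k)) ⬝ᵥ ((Bᵀ * B) *ᵥ fun k => y (t, c, k)) = _
    rw [← Matrix.mulVec_mulVec, Matrix.dotProduct_mulVec, Matrix.vecMul_transpose]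
    simp [dotProduct, sq]
  rw [dotProduct, Fintype.sum_prod_type]
  refine Finset.sum_congr rfl fun t _ => ?_
  rw [Fintype.sum_prod_type, Fin.sum_univ_two, hyy, hyy, ← Finset.sum_add_distrib]
  refine Finset.sum_congr rfl fun k _ => ?_
  rw [← Complex.normSq_eq_norm_sq, Complex.normSq_apply, ← sq, ← sq]
  simp only [hy, Matrix.mulVec, dotProduct, Matrix.mul_apply]
  congr 2
  · rw [Complex.re_sum]
    refine Finset.sum_congr rfl fun l _ => ?_
    have := precodingMatrix_transpose_mulVec G a t 0 l
    simp only [Matrix.mulVec, dotProduct] at this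
    rw [this]
    simp
  · rw [Complex.im_sum]
    refine Finset.sum_congr rfl fun l _ => ?_
    have := precodingMatrix_transpose_mulVec G a t 1 l
    simp only [Matrix.mulVec, dotProduct] at this
    rw [this]
    simp

/-! ### Non-vanishing determinant and short vectors. -/

theorem codeword_ne_zero {G : Matrix (Fin K × Fin K) (Fin N) ℂ} (hG : Gᴴ * G = 1)
    {s : Fin N → GaussianInt} (hs : s ≠ 0) : codeword G s ≠ 0 := by
  intro h
  have h0 : (G *ᵥ fun n => GaussianInt.toComplex (s n)) = 0 := by
    funext ⟨t, k⟩
    exact congrFun (congrFun h k) t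
  have h1 : (fun n => GaussianInt.toComplex (s n)) = 0 := by
    rw [← Matrix.one_mulVec fun n => GaussianInt.toComplex (s n), ← hG, ← Matrix.mulVec_mulVec, h0,
      Matrix.mulVec_zero]
  exact hs (funext fun n => by simpa using congrFun h1 n)

theorem minDet_le {G : Matrix (Fin K × Fin K) (Fin N) ℂ} (hG : Gᴴ * G = 1)
    {s : Fin N → GaussianInt} (hs : s ≠ 0) : minDet G ≤ ‖(codeword G s).det‖ ^ 2 :=
  csInf_le ⟨0, by rintro _ ⟨X, -, rfl⟩; positivity⟩
    ⟨_, ⟨⟨s, rfl⟩, codeword_ne_zero hG hs⟩, rfl⟩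

/-- The filtered codeword `B X` has `|det (B X)|² = det (BᵀB) |det X|²`, and its squared determinant
is at most the `K`-th power of its squared Frobenius norm, the effective variance. -/
theorem minDet_mul_det_le {G : Matrix (Fin K × Fin K) (Fin N) ℂ} (hG : Gᴴ * G = 1) (d : ℝ)
    (C : Matrix (Fin K) (Fin K) ℝ) (hC : (1 + (1 / d) • C).PosSemidef)
    {a : Fin 2 × Fin N → ℤ} (ha : a ≠ 0) :
    minDet G * (1 + (1 / d) • C).det ≤
      effectiveVariance d (precodingMatrix G * stackedCovariance C * (precodingMatrix G)ᵀ) a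
        ^ K := by
  obtain ⟨B, hB⟩ := hC.exists_transpose_mul_self
  rw [effectiveVariance_eq hG d C B hB]
  have hs : (fun n => ⟨a (0, n), a (1, n)⟩ : Fin N → GaussianInt) ≠ 0 := by
    intro h
    refine ha (funext fun ⟨c, n⟩ => ?_)
    have hn := congrFun h n
    fin_cases c
    · exact congrArg Zsqrtd.re hn
    · exact congrArg Zsqrtd.im hn
  have h := norm_det_sq_le (B.map Complex.ofReal * codeword G fun n => ⟨a (0, n), a (1, n)⟩)
  rw [Fintype.card_fin] at h
  refine le_trans ?_ h
  have hBdet : (B.map Complex.ofReal).det = (B.det : ℂ) := (RingHom.map_det Complex.ofRealHom B).symm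
  rw [Matrix.det_mul, hBdet, norm_mul, mul_pow, hB, Matrix.det_mul, Matrix.det_transpose,
    Complex.norm_real, Real.norm_eq_abs, sq_abs, ← sq, mul_comm]
  exact mul_le_mul_of_nonneg_left (minDet_le hG hs) (sq_nonneg _)

/-- With zero covariance and a standard basis vector, both the determinant and the effective
variance in `minDet_mul_det_le` equal `1`. -/
theorem minDet_le_one (hN : 0 < N) {G : Matrix (Fin K × Fin K) (Fin N) ℂ} (hG : Gᴴ * G = 1) :
    minDet G ≤ 1 := by
  have ha : (Pi.single ((0 : Fin 2), (⟨0, hN⟩ : Fin N)) 1 : Fin 2 × Fin N → ℤ) ≠ 0 := by simp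
  have h := minDet_mul_det_le hG 1 0 (by simpa using Matrix.PosSemidef.one) ha
  have h0 : stackedCovariance (0 : Matrix (Fin K) (Fin K) ℝ) = 0 := by simp [stackedCovariance]
  have hsum : ∀ i, (((Pi.single ((0 : Fin 2), (⟨0, hN⟩ : Fin N)) 1 : Fin 2 × Fin N → ℤ) i : ℤ) : ℝ)
      = (Pi.single ((0 : Fin 2), (⟨0, hN⟩ : Fin N)) 1 : Fin 2 × Fin N → ℝ) i := fun i => by
    simp only [Pi.single_apply]; split_ifs <;> simp
  simpa [effectiveVariance, h0, hsum] using h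

/-! ### The optimal integer matrix. -/

theorem effectiveVariance_eq_dotProduct {ι : Type*} [Fintype ι] [DecidableEq ι] (d : ℝ)
    (C B : Matrix ι ι ℝ) (hB : 1 + (1 / d) • C = Bᵀ * B) (a : ι → ℤ) :
    effectiveVariance d C a = B *ᵥ (fun i => (a i : ℝ)) ⬝ᵥ B *ᵥ (fun i => (a i : ℝ)) := by
  rw [effectiveVariance, hB, ← Matrix.mulVec_mulVec, Matrix.dotProduct_mulVec,
    Matrix.vecMul_transpose]

/-- If every nonzero integer combination has effective variance at least `μ`, then so does the
optimal integer-forcing matrix, and its largest effective variance is controlled by the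
determinant. -/
theorem iInf_effectiveVariance_bounds {ι : Type*} [Fintype ι] [DecidableEq ι] [Nonempty ι]
    (d : ℝ) (C : Matrix ι ι ℝ) (hC : (1 + (1 / d) • C).PosSemidef)
    (hdet : (1 + (1 / d) • C).det ≠ 0) {μ : ℝ} (hμ : 0 < μ)
    (hmin : ∀ a : ι → ℤ, a ≠ 0 → μ ≤ effectiveVariance d C a) :
    μ ≤ (⨅ A : {A : Matrix ι ι ℤ // A.det ≠ 0}, ⨆ k, effectiveVariance d C (A.1 k)) ∧
    (⨅ A : {A : Matrix ι ι ℤ // A.det ≠ 0}, ⨆ k, effectiveVariance d C (A.1 k)) *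
        μ ^ (Fintype.card ι - 1) ≤
      (Fintype.card ι : ℝ) ^ Fintype.card ι * (1 + (1 / d) • C).det := by
  have hlow : ∀ A : {A : Matrix ι ι ℤ // A.det ≠ 0}, μ ≤ ⨆ k, effectiveVariance d C (A.1 k) := by
    rintro ⟨A, hA⟩
    have k := Classical.arbitrary ι
    refine Finite.le_ciSup_of_le k (hmin _ fun h => hA ?_)
    exact Matrix.det_eq_zero_of_row_eq_zero k (congrFun h)
  have : Nonempty {A : Matrix ι ι ℤ // A.det ≠ 0} := ⟨1, by simp⟩
  refine ⟨le_ciInf hlow, ?_⟩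
  obtain ⟨B, hB⟩ := hC.exists_transpose_mul_self
  have hBdet : (1 + (1 / d) • C).det = B.det ^ 2 := by
    rw [hB, Matrix.det_mul, Matrix.det_transpose, sq]
  rw [hBdet]
  have hQ := effectiveVariance_eq_dotProduct d C B hB
  refine mul_pow_le_card_pow_mul_det_sq B (fun h => hdet (by rw [hBdet, h]; simp)) hμ
    (le_ciInf hlow) (fun x hx => hQ x ▸ hmin x hx) fun A hA => ?_
  -- The maximum over the finitely many rows is attained, so an invertible matrix with all rows
  -- below the infimum would contradict the infimum.
  by_contra hA0
  obtain ⟨k, hk⟩ := exists_eq_ciSup_of_finite (f := fun k => effectiveVariance d C (A k))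
  have h1 := ciInf_le ⟨μ, by rintro _ ⟨A, rfl⟩; exact hlow A⟩
    (⟨A, hA0⟩ : {A : Matrix ι ι ℤ // A.det ≠ 0})
    (f := fun A : {A : Matrix ι ι ℤ // A.det ≠ 0} => ⨆ k, effectiveVariance d C (A.1 k))
  have h2 := hA k
  rw [← hQ] at h2
  simp only [← hk] at h1
  exact absurd h2 (not_lt.2 h1)

end IFSource

/-! ### The rate gap. -/

theorem mainTheorem3 (K N : ℕ) (hK : 1 ≤ K) (G : Matrix (Fin K × Fin K) (Fin N) ℂ)
    (hG : IFSource.IsPerfectCode G) (d : ℝ) (hd : 0 < d)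
    (Kxx : Matrix (Fin K) (Fin K) ℝ) (hKxx : Kxx.PosSemidef) :
    IFSource.spaceTimeRate d Kxx G - IFSource.bergerTungRate d Kxx ≤
      2 * (K : ℝ) ^ 3 * Real.logb 2 (2 * (K : ℝ) ^ 2) +
        (K : ℝ) ^ 2 * Real.logb 2 (1 / IFSource.minDet G) := by
  obtain ⟨rfl, hδ, hGl, hGr⟩ := hG
  have hK0 : 0 < K := hK
  have hKR : 1 ≤ (K : ℝ) := by exact_mod_cast hK
  have hKR0 : (K : ℝ) ≠ 0 := by positivity
  have hKK : 0 < K * K := Nat.mul_pos hK0 hK0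
  have : Nonempty (Fin (K * K)) := ⟨⟨0, hKK⟩⟩
  have hS : (1 + (1 / d) • Kxx).PosDef :=
    Matrix.PosDef.one.add_posSemidef (hKxx.smul (by positivity))
  have hD : 0 < (1 + (1 / d) • Kxx).det := hS.det_pos
  have hdet := IFSource.det_one_add_smul_conj hGr d Kxx
  have hle := fun a : Fin 2 × Fin (K * K) → ℤ => fun ha : a ≠ 0 =>
    IFSource.minDet_mul_det_le hGl d Kxx hS.posSemidef ha
  have hM : (1 + (1 / d) • (IFSource.precodingMatrix G * IFSource.stackedCovariance Kxx *
      (IFSource.precodingMatrix G)ᵀ)).PosSemidef := by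
    rw [IFSource.one_add_smul_conj_eq hGl]
    have h := ((Matrix.PosSemidef.one (n := Fin K) (R := ℝ)).kronecker
      ((Matrix.PosSemidef.one (n := Fin 2) (R := ℝ)).kronecker
        hS.posSemidef)).mul_mul_conjTranspose_same (IFSource.precodingMatrix G)
    rwa [Matrix.conjTranspose_eq_transpose_of_trivial] at h
  have hδ1 := IFSource.minDet_le_one hKK hGl
  rw [IFSource.spaceTimeRate, IFSource.integerForcingRate, IFSource.bergerTungRate]
  set D := (1 + (1 / d) • Kxx).det
  set δ := IFSource.minDet G
  set C := IFSource.precodingMatrix G * IFSource.stackedCovariance Kxx *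
    (IFSource.precodingMatrix G)ᵀ
  set μ := (δ * D) ^ (1 / (K : ℝ)) with hμdef
  have hμ : 0 < μ := by positivity
  have hμK : μ ^ K = δ * D := by
    rw [hμdef, one_div, Real.rpow_inv_natCast_pow (by positivity) hK0.ne']
  have hmin : ∀ a : Fin 2 × Fin (K * K) → ℤ, a ≠ 0 → μ ≤ IFSource.effectiveVariance d C a := by
    intro a ha
    have h0 : 0 ≤ IFSource.effectiveVariance d C a := by
      obtain ⟨B, hB⟩ := hM.exists_transpose_mul_self
      rw [IFSource.effectiveVariance_eq_dotProduct d C B hB]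
      exact Finset.sum_nonneg fun i _ => mul_self_nonneg _
    exact le_of_pow_le_pow_left₀ hK0.ne' h0 (hμK ▸ hle a ha)
  obtain ⟨hr1, hr2⟩ := IFSource.iInf_effectiveVariance_bounds d C hM
    (by rw [hdet]; positivity) hμ hmin
  set r := ⨅ A : {A : Matrix (Fin 2 × Fin (K * K)) (Fin 2 × Fin (K * K)) ℤ // A.det ≠ 0},
    ⨆ k, IFSource.effectiveVariance d C (A.1 k)
  have hr : 0 < r := hμ.trans_le hr1
  have hcard : Fintype.card (Fin 2 × Fin (K * K)) = 2 * (K * K) := by simp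
  rw [hdet, hcard] at hr2
  have hcast : ((2 * (K * K) : ℕ) : ℝ) = 2 * (K : ℝ) ^ 2 := by push_cast; ring
  have hcast1 : ((2 * (K * K) - 1 : ℕ) : ℝ) = 2 * (K : ℝ) ^ 2 - 1 := by
    rw [Nat.cast_sub (by omega), hcast, Nat.cast_one]
  have hn : 1 ≤ 2 * (K : ℝ) ^ 2 := by nlinarith
  have hlog := Real.logb_le_logb_of_le one_lt_two (by positivity) hr2
  rw [Real.logb_mul (by positivity) (by positivity), Real.logb_mul (by positivity) (by positivity),
    Real.logb_pow, Real.logb_pow, Real.logb_pow, hcast1, hcast] at hlog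
  have hlogμ := congrArg (Real.logb 2) hμK
  rw [Real.logb_pow, Real.logb_mul hδ.ne' hD.ne'] at hlogμ
  have hlogn : 0 ≤ Real.logb 2 (2 * (K : ℝ) ^ 2) := Real.logb_nonneg one_lt_two hn
  have hlogδ : Real.logb 2 δ ≤ 0 := Real.logb_nonpos one_lt_two hδ.le hδ1
  rw [hcard, hcast, one_div δ, Real.logb_inv]
  push_cast at hlog
  set x := Real.logb 2 r
  set n := Real.logb 2 (2 * (K : ℝ) ^ 2)
  set m := Real.logb 2 μ
  -- In the exponent of `D`, `K/2 · (2K - (2K² - 1)/K) = 1/2`: the Berger–Tung rate appears because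
  -- only `n - 1` of the `n` minima are replaced by `μ`.
  have hx : (K : ℝ) / 2 * x ≤ (K : ℝ) ^ 3 * n + 1 / 2 * Real.logb 2 D
      - ((K : ℝ) ^ 2 - 1 / 2) * Real.logb 2 δ := by
    have h1 := mul_le_mul_of_nonneg_left hlog (by positivity : 0 ≤ (K : ℝ) / 2)
    linear_combination h1 - ((K : ℝ) ^ 2 - 1 / 2) * hlogμ
  have hkn : 0 ≤ (K : ℝ) ^ 3 * n := by positivity
  have hrate : 1 / (2 * (K : ℝ)) * (2 * (K : ℝ) ^ 2 / 2 * x) = (K : ℝ) / 2 * x := by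
    field_simp
  rw [hrate]
  -- The bound obtained is sharper than required; the slack is `K³ log (2K²) ≥ 0` and `½ log (1/δ) ≥
  -- 0`.
  linarith
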